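/- Let $p$ be a prime with $p\not\equiv 1 \pmod 3$ and let $q=p^k>4$. Let $\mathbb F=\mathbb F_q$, let $\mathbb K=\mathbb F_{q^3}$, and let $N:\mathbb K\to\mathbb F$, $N(X)=X\cdot X^{q}\cdot X^{q^2}$, be the norm of the extension $\mathbb K/\mathbb F$. Then there exists an element $A\in\mathbb K$ with $N(A)=1$ and $A\neq 1$ such that the system of equations $$N(X)=1,\qquad N(X+1)=-1,\qquad N(X+A)=-1$$ has exactly six distinct solutions $X\in\mathbb K$. -/

import Mathlib

/-!
Write `σ` for the Frobenius `x ↦ x ^ q` of `K / F`, so that `N X = X * σ X * σ (σ X)`.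

**Six solutions.** The elements with `N X = 1` and `N (X + 1) = -1` are exactly those of the set `D`
given by `σ X * X + X + 1 = 0` together with those of the set `D⁻¹` of their inverses, given by
`σ X * X + σ X + 1 = 0` (`norm_conditions_iff`). If `N A = 1`, then `X` solves the system if and only
if both `X` and `A / X` lie in `D ∪ D⁻¹` (`solution_iff_factorization`). For `A ≠ 1` there is
exactly one factorization `A = P * Q` with `P ∈ D`, `Q ∈ D⁻¹`, while the factors in a factorization
inside `D`, or inside `D⁻¹`, are the roots of a quadratic determined by `A`. So there are six
solutions as soon as both quadratics split into distinct factors and no degenerate coincidence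
occurs (`ncard_solutions_eq_six`).

**Reduction to cubics.** Write `A = σ a / a`, and let `e₁, e₂, e₃` be the elementary symmetric
functions of the conjugates of `a`. The two quadratics split if and only if `S ^ 2 + e₁ S + e₂` and
`R ^ 2 + e₂ R + e₁ e₃` split over `F`, and the degenerate cases are `e₁ ^ 2 = 3 e₂` and
`e₂ ^ 2 = 3 e₁ e₃` (the direction needed is `ncard_solutions_eq_six_of_splitting`). It remains to
find `e₁, e₂, e₃` in `F` with these properties such that `t ^ 3 - e₁ t ^ 2 + e₂ t - e₃` has no root
in `F` (`exists_ncard_eq_six_of_cubic`).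

**Finding the cubic.**
* If `2` and `3` are nonzero in `F`, take `t ^ 3 - t - e` with `e` outside the image of the
  noninjective map `t ↦ t ^ 3 - t`.
* In characteristic three take `a = 1 / ξ + κ` with `ξ ^ 3 - ξ = η`. The splitting conditions say
  that `1 - κ η` and `1 + κ ^ 3 η` are nonzero squares; this is solved by a rational
  parametrization, and counting gives a parameter for which `η` is not of the form `x ^ 3 - x`.
* In characteristic two let `V` be the group of elements `x ^ 2 + x`, of index two. Take `e₁ = 1`,
  `e₂ = b ∈ V`, and `e₃ ∈ b ^ 2 V`. The map `t ↦ t ^ 3 + t ^ 2 + b t` sends exactly the `t` with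
  `t ^ 3 / b ^ 2 ∈ V` into `b ^ 2 V`, and it has three zeros, so it misses a suitable `e₃` once at
  most `q / 2` elements `t` satisfy `t ^ 3 / b ^ 2 ∈ V` (`exists_ncard_eq_six_of_card_le`). If cubing is
  bijective, there are exactly `q / 2` of them. Otherwise their number depends only on whether `b` is
  a cube; an average over all `b ≠ 0` shows that one of the two classes is good, and for `q > 16`
  both classes meet `V` outside `{0, 1}`. For `q = 16` an explicit cubic works.
-/

/-! ### Counting the solutions for a norm-one element -/

section Sixfold

variable {K : Type*} [Field K] {σ : K →+* K}

/-- Eliminating `σ (σ X)` by the first norm equation makes the second one factor into the equations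
of the two sets `D` and `D⁻¹`. -/
theorem norm_conditions_iff (hσ : ∀ x, σ (σ (σ x)) = x) (X : K) :
    (X * σ X * σ (σ X) = 1 ∧ (X + 1) * σ (X + 1) * σ (σ (X + 1)) = -1) ↔
      (σ X * X + X + 1 = 0 ∨ σ X * X + σ X + 1 = 0) := by
  simp only [map_add, map_one]
  have inv_case : ∀ Y : K, σ Y * Y + Y + 1 = 0 →
      Y * σ Y * σ (σ Y) = 1 ∧ (Y + 1) * (σ Y + 1) * (σ (σ Y) + 1) = -1 := by
    intro Y h1
    have h2 := congrArg σ h1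
    have h3 := congrArg σ h2
    simp only [map_add, map_mul, map_one, map_zero, hσ] at h2 h3
    have hN : Y * σ Y * σ (σ Y) = 1 := by
      linear_combination σ (σ Y) * h1 - h3
    refine ⟨hN, ?_⟩
    have e1 : Y + 1 = -(σ Y * Y) := by linear_combination h1
    have e2 : σ Y + 1 = -(σ (σ Y) * σ Y) := by linear_combination h2
    have e3 : σ (σ Y) + 1 = -(Y * σ (σ Y)) := by linear_combination h3
    rw [e1, e2, e3]
    linear_combination (-1 - Y * σ Y * σ (σ Y)) * hN
  constructor
  · rintro ⟨h1, h2⟩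
    have : (σ X * X + X + 1) * (σ X * X + σ X + 1) = 0 := by
      linear_combination (X * σ X) * h2 + (-(X + 1) * (σ X + 1)) * h1
    exact mul_eq_zero.mp this
  · rintro (h | h)
    · exact inv_case X h
    · have h2 := congrArg σ h
      have h3 := congrArg σ h2
      simp only [map_add, map_mul, map_one, map_zero, hσ] at h2 h3
      have hN : X * σ X * σ (σ X) = 1 := by
        linear_combination σ (σ X) * h - h2
      refine ⟨hN, ?_⟩
      have e1 : X + 1 = -(X * σ (σ X)) := by linear_combination h3
      have e2 : σ X + 1 = -(σ X * X) := by linear_combination h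
      have e3 : σ (σ X) + 1 = -(σ (σ X) * σ X) := by linear_combination h2
      rw [e1, e2, e3]
      linear_combination (-1 - X * σ X * σ (σ X)) * hN

/-- If `N X = 1`, then `N (X + A) = N (A / X + 1)`, so the third equation says that `A / X` satisfies
the same condition as `X`. -/
theorem solution_iff_factorization (hσ : ∀ x, σ (σ (σ x)) = x) {A : K}
    (hA : A * σ A * σ (σ A) = 1) (X : K) :
    (X * σ X * σ (σ X) = 1 ∧ (X + 1) * σ (X + 1) * σ (σ (X + 1)) = -1 ∧
        (X + A) * σ (X + A) * σ (σ (X + A)) = -1) ↔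
      ∃ Y, X * Y = A ∧ (σ X * X + X + 1 = 0 ∨ σ X * X + σ X + 1 = 0) ∧
        (σ Y * Y + Y + 1 = 0 ∨ σ Y * Y + σ Y + 1 = 0) := by
  constructor
  · rintro ⟨h1, h2, h3⟩
    have hX : X ≠ 0 := by rintro rfl; simp at h1
    refine ⟨A / X, by field_simp, (norm_conditions_iff hσ X).1 ⟨h1, h2⟩,
      (norm_conditions_iff hσ _).1 ?_⟩
    obtain ⟨Y, rfl⟩ : ∃ Y, A = X * Y := ⟨A / X, by field_simp⟩
    rw [mul_div_cancel_left₀ _ hX]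
    simp only [map_add, map_mul, map_one] at hA h3 ⊢
    constructor
    · linear_combination hA - Y * σ Y * σ (σ Y) * h1
    · linear_combination h3 - (Y + 1) * (σ Y + 1) * (σ (σ Y) + 1) * h1
  · rintro ⟨Y, rfl, hX, hY⟩
    obtain ⟨h1, h2⟩ := (norm_conditions_iff hσ X).2 hX
    obtain ⟨h3, h4⟩ := (norm_conditions_iff hσ Y).2 hY
    refine ⟨h1, h2, ?_⟩
    simp only [map_add, map_mul, map_one] at h4 ⊢
    linear_combination h4 + (Y + 1) * (σ Y + 1) * (σ (σ Y) + 1) * h1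

/-- The factorizations `A = U * V` in `D` and `A = W * T` in `D⁻¹` give four solutions; the last two
are the factors of the unique mixed factorization of `A`. The set `D ∩ D⁻¹` consists of the elements
fixed by `σ` with `X ^ 2 + X + 1 = 0`, so the hypotheses `σ U ≠ U` etc. keep the two kinds of factors
apart. -/
theorem ncard_solutions_eq_six (hσ : ∀ x, σ (σ (σ x)) = x) {A U V W T : K}
    (hA : A * σ A * σ (σ A) = 1) (hA1 : A ≠ 1) (hA2 : σ A = A → A ^ 2 + A + 1 ≠ 0)
    (hU : σ U * U + U + 1 = 0) (hV : σ V * V + V + 1 = 0) (hUV : U * V = A) (hUV' : U ≠ V)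
    (hW : σ W * W + σ W + 1 = 0) (hT : σ T * T + σ T + 1 = 0) (hWT : W * T = A) (hWT' : W ≠ T)
    (hU' : σ U ≠ U) (hV' : σ V ≠ V) (hW' : σ W ≠ W) (hT' : σ T ≠ T) :
    {X : K | X * σ X * σ (σ X) = 1 ∧ (X + 1) * σ (X + 1) * σ (σ (X + 1)) = -1 ∧
        (X + A) * σ (X + A) * σ (σ (X + A)) = -1}.ncard = 6 := by
  have hA0 : A ≠ 0 := by rintro rfl; simp at hA
  have fixed : ∀ X : K, σ X * X + X + 1 = 0 → σ X * X + σ X + 1 = 0 → σ X = X := by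
    intro X h1 h2; linear_combination h2 - h1
  have hσ1 : σ A ≠ 1 := fun h => hA1 (σ.injective (h.trans (map_one σ).symm))
  have hσσ1 : σ (σ A) - 1 ≠ 0 := fun h => hσ1 (σ.injective ((sub_eq_zero.mp h).trans (map_one σ).symm))
  obtain ⟨P, Q, hP, hQ, hPQ⟩ : ∃ P Q, σ P * P + P + 1 = 0 ∧ σ Q * Q + σ Q + 1 = 0 ∧
      P * Q = A := by
    -- The relation below is forced by `P * Q = A` and the equations for `P` and `Q`.
    obtain ⟨Q, hQA⟩ : ∃ Q, Q * (σ (σ A) - 1) = 1 - σ (σ A) * A :=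
      ⟨(1 - σ (σ A) * A) / (σ (σ A) - 1), div_mul_cancel₀ _ hσσ1⟩
    have hσQA := congrArg σ hQA
    simp only [map_sub, map_mul, map_one, hσ] at hσQA
    have hA1' : A - 1 ≠ 0 := sub_ne_zero.mpr hA1
    have hQ : σ Q * Q + σ Q + 1 = 0 := by
      refine (mul_eq_zero.mp ?_).resolve_right (mul_ne_zero hA1' hσσ1)
      linear_combination (1 - A * σ A) * hQA + ((σ (σ A) - 1) + Q * (σ (σ A) - 1)) * hσQA + (A - 1) * hA
    have hQ0 : Q ≠ 0 := by rintro rfl; simp at hQ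
    have hσQ0 : σ Q ≠ 0 := (map_ne_zero σ).mpr hQ0
    refine ⟨A / Q, Q, ?_, hQ, div_mul_cancel₀ _ hQ0⟩
    rw [map_div₀]
    field_simp
    linear_combination hQ + hσQA
  have hP0 : P ≠ 0 := left_ne_zero_of_mul (hPQ ▸ hA0)
  have hQ0 : Q ≠ 0 := right_ne_zero_of_mul (hPQ ▸ hA0)
  have two_roots : ∀ {X Y B C : K}, X * Y = A → B * C = A → X + Y = B + C → X = B ∨ X = C := by
    intro X Y B C h1 h2 h3
    have : (X - B) * (X - C) = 0 := by linear_combination X * h3 - h1 + h2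
    simpa only [mul_eq_zero, sub_eq_zero] using this
  -- By `sum_left` and `sum_right`, `A` determines the sum of two factors of the same kind.
  have sum_left : ∀ {X Y : K}, X * Y = A → σ X * X + X + 1 = 0 → σ Y * Y + Y + 1 = 0 →
      X + Y = A * σ A - A - 1 := by
    intro X Y h h1 h2
    rw [← h, map_mul]
    linear_combination (Y + 1) * h1 - σ X * X * h2
  have sum_right : ∀ {X Y : K}, X * Y = A → σ X * X + σ X + 1 = 0 → σ Y * Y + σ Y + 1 = 0 →
      σ A * (X + Y) = 1 - σ A * A - σ A := by
    intro X Y h h1 h2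
    rw [← h, map_mul]
    linear_combination σ X * (X + 1) * h2 - h1
  have mixed : ∀ {X Y : K}, X * Y = A → σ X * X + X + 1 = 0 → σ Y * Y + σ Y + 1 = 0 →
      (A - 1) * σ Y = 1 - A * σ A := by
    intro X Y h h1 h2
    rw [← h, map_mul]
    linear_combination Y * σ Y * h1 - h2
  have mixed_unique : ∀ {X Y : K}, X * Y = A → σ X * X + X + 1 = 0 → σ Y * Y + σ Y + 1 = 0 →
      X = P ∧ Y = Q := by
    intro X Y h h1 h2
    have hY : Y = Q := σ.injective (mul_left_cancel₀ (sub_ne_zero.mpr hA1)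
      ((mixed h h1 h2).trans (mixed hPQ hP hQ).symm))
    subst hY
    exact ⟨mul_right_cancel₀ hQ0 (h.trans hPQ.symm), rfl⟩
  have set_eq : {X : K | X * σ X * σ (σ X) = 1 ∧ (X + 1) * σ (X + 1) * σ (σ (X + 1)) = -1 ∧
        (X + A) * σ (X + A) * σ (σ (X + A)) = -1} = {U, V, P, W, T, Q} := by
    ext X
    rw [Set.mem_ofPred_eq, solution_iff_factorization hσ hA]
    simp only [Set.mem_insert_iff, Set.mem_singleton_iff]
    constructor
    · rintro ⟨Y, h, h1 | h1, h2 | h2⟩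
      · rcases two_roots h hUV ((sum_left h h1 h2).trans (sum_left hUV hU hV).symm) with h3 | h3 <;>
          simp [h3]
      · simp [(mixed_unique h h1 h2).1]
      · simp [(mixed_unique ((mul_comm Y X).trans h) h2 h1).2]
      · rcases two_roots h hWT (mul_left_cancel₀ ((map_ne_zero σ).mpr hA0)
          ((sum_right h h1 h2).trans (sum_right hWT hW hT).symm)) with h3 | h3 <;> simp [h3]
    · rintro (rfl | rfl | rfl | rfl | rfl | rfl)
      · exact ⟨V, hUV, .inl hU, .inl hV⟩
      · exact ⟨U, (mul_comm _ _).trans hUV, .inl hV, .inl hU⟩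
      · exact ⟨Q, hPQ, .inl hP, .inr hQ⟩
      · exact ⟨T, hWT, .inr hW, .inr hT⟩
      · exact ⟨W, (mul_comm _ _).trans hWT, .inr hT, .inr hW⟩
      · exact ⟨P, (mul_comm _ _).trans hPQ, .inr hQ, .inl hP⟩
  have hUP : U ≠ P := by
    rintro rfl
    have : V = Q := mul_left_cancel₀ hP0 (hUV.trans hPQ.symm)
    exact hV' (fixed V hV (this ▸ hQ))
  have hVP : V ≠ P := by
    rintro rfl
    have : U = Q := mul_left_cancel₀ hP0 ((mul_comm _ _).trans (hUV.trans hPQ.symm))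
    exact hU' (fixed U hU (this ▸ hQ))
  have hWQ : W ≠ Q := by
    rintro rfl
    have : T = P := mul_left_cancel₀ hQ0 (hWT.trans (hPQ.symm.trans (mul_comm _ _)))
    exact hT' (fixed T (this ▸ hP) hT)
  have hTQ : T ≠ Q := by
    rintro rfl
    have : W = P := mul_right_cancel₀ hQ0 (hWT.trans hPQ.symm)
    exact hW' (fixed W (this ▸ hP) hW)
  have hPQ' : P ≠ Q := by
    rintro rfl
    have hfix := fixed P hP hQ
    rw [hfix] at hP
    refine hA2 (by rw [← hPQ, map_mul, hfix]) ?_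
    rw [← hPQ]
    linear_combination (P ^ 2 - P + 1) * hP
  have hUW : U ≠ W := by rintro rfl; exact hU' (fixed U hU hW)
  have hUT : U ≠ T := by rintro rfl; exact hU' (fixed U hU hT)
  have hUQ : U ≠ Q := by rintro rfl; exact hU' (fixed U hU hQ)
  have hVW : V ≠ W := by rintro rfl; exact hV' (fixed V hV hW)
  have hVT : V ≠ T := by rintro rfl; exact hV' (fixed V hV hT)
  have hVQ : V ≠ Q := by rintro rfl; exact hV' (fixed V hV hQ)
  have hPW : P ≠ W := by rintro rfl; exact hW' (fixed P hP hW)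
  have hPT : P ≠ T := by rintro rfl; exact hT' (fixed P hP hT)
  rw [set_eq]
  repeat rw [Set.ncard_insert_of_notMem (by simp [*])]
  rw [Set.ncard_singleton]

/-- For `A = σ a / a` with conjugates `a, y, z` of `a`, the factors of `A` are explicit:
`(z + s) / a` and `(z + s') / a` in `D`, and `y z / (a y + r)` and `y z / (a y + r')` in `D⁻¹`. A factor
fixed by `σ` would be a root `w` of `w ^ 2 + w + 1` scaling the differences of the conjugates
cyclically, which forces `e₁ ^ 2 = 3 e₂` or `e₂ ^ 2 = 3 e₁ e₃`. -/
theorem ncard_solutions_eq_six_of_splitting (hσ : ∀ x, σ (σ (σ x)) = x) {a e₁ e₂ e₃ s s' r r' : K}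
    (he₁ : a + σ a + σ (σ a) = e₁) (he₂ : a * σ a + σ a * σ (σ a) + σ (σ a) * a = e₂)
    (he₃ : a * σ a * σ (σ a) = e₃) (ha : a ≠ 0)
    (hs : σ s = s) (hs' : σ s' = s') (hr : σ r = r) (hr' : σ r' = r')
    (hss : s ≠ s') (hss₁ : s + s' = -e₁) (hss₂ : s * s' = e₂)
    (hrr : r ≠ r') (hrr₁ : r + r' = -e₂) (hrr₂ : r * r' = e₁ * e₃)
    (hne₁ : e₁ ^ 2 ≠ 3 * e₂) (hne₂ : e₂ ^ 2 ≠ 3 * (e₁ * e₃)) :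
    (σ a / a) * σ (σ a / a) * σ (σ (σ a / a)) = 1 ∧ σ a / a ≠ 1 ∧
    {X : K | X * σ X * σ (σ X) = 1 ∧ (X + 1) * σ (X + 1) * σ (σ (X + 1)) = -1 ∧
        (X + σ a / a) * σ (X + σ a / a) * σ (σ (X + σ a / a)) = -1}.ncard = 6 := by
  obtain ⟨y, hy⟩ : ∃ y, σ a = y := ⟨_, rfl⟩
  obtain ⟨z, hz⟩ : ∃ z, σ y = z := ⟨_, rfl⟩
  have hx : σ z = a := by rw [← hz, ← hy, hσ]
  rw [hy, hz] at he₁ he₂ he₃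
  rw [hy]
  have hy0 : y ≠ 0 := hy ▸ (map_ne_zero σ).mpr ha
  have hz0 : z ≠ 0 := hz ▸ (map_ne_zero σ).mpr hy0
  have hA : y / a * σ (y / a) * σ (σ (y / a)) = 1 := by
    simp only [map_div₀, hx, hy, hz]
    field_simp
  have hA1 : y / a ≠ 1 := by
    intro h
    have h1 : y = a := (div_eq_one_iff_eq ha).mp h
    have h2 : z = y := by rw [← hz, h1, hy, h1]
    apply hne₁
    rw [← he₁, ← he₂, h2, h1]
    ring
  have hquad : (z + s) * (z + s') = a * y := by
    linear_combination z * hss₁ + hss₂ + z * he₁ - he₂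
  have hquad' : (a * y + r) * (a * y + r') = a * y * z ^ 2 := by
    linear_combination a * y * hrr₁ + hrr₂ + a * y * he₂ - e₁ * he₃ - a * y * z * he₁
  have hne₁' : ∀ w, w ^ 2 + w + 1 = 0 → z - a = w * (a - y) → a - y = w * (y - z) → False := by
    intro w hw h1 h2
    apply hne₁
    rw [← he₁, ← he₂]
    linear_combination (y - z) ^ 2 * hw + (a - y + (w + 1) * (y - z)) * h2
  have left_root : ∀ t, σ t = t → t ^ 2 + e₁ * t + e₂ = 0 →
      σ ((z + t) / a) * ((z + t) / a) + (z + t) / a + 1 = 0 ∧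
      σ ((z + t) / a) ≠ (z + t) / a := by
    intro t ht h
    have h1 : σ ((z + t) / a) * ((z + t) / a) + (z + t) / a + 1 = 0 := by
      simp only [map_div₀, map_add, hx, hy, ht]
      field_simp
      linear_combination h + t * he₁ + he₂
    refine ⟨h1, fun h2 => ?_⟩
    obtain ⟨w, hw⟩ : ∃ w, (z + t) / a = w := ⟨_, rfl⟩
    rw [h2, hw] at h1
    rw [hw] at h2
    have h3 : z + t = w * a := by rw [← hw]; field_simp
    have h4 := congrArg σ h3
    have h5 := congrArg σ h4
    simp only [map_add, map_mul, ht, hx, hy, hz, h2] at h4 h5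
    exact hne₁' w (by linear_combination h1) (by linear_combination h3 - h4)
      (by linear_combination h4 - h5)
  have right_root : ∀ t, σ t = t → t ^ 2 + e₂ * t + e₁ * e₃ = 0 → a * y + t ≠ 0 →
      σ (y * z / (a * y + t)) * (y * z / (a * y + t)) + σ (y * z / (a * y + t)) + 1 = 0 ∧
      σ (y * z / (a * y + t)) ≠ y * z / (a * y + t) := by
    intro t ht h h0
    have h0' : y * z + t ≠ 0 := by
      have := (map_ne_zero σ).mpr h0
      simpa only [map_add, map_mul, ht, hy, hz] using this
    obtain ⟨w, hw⟩ : ∃ w, y * z / (a * y + t) = w := ⟨_, rfl⟩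
    have h3 : y * z = w * (a * y + t) := by rw [← hw, div_mul_cancel₀ _ h0]
    rw [hw]
    have h1 : σ w * w + σ w + 1 = 0 := by
      have h4 := congrArg σ h3
      simp only [map_add, map_mul, ht, hx, hy, hz] at h4
      refine (mul_eq_zero.mp ?_).resolve_right (mul_ne_zero h0 h0')
      linear_combination h + t * he₂ + e₁ * he₃ + a * y * z * he₁ -
        (σ w * (y * z + t)) * h3 - (y * z + a * y + t) * h4
    refine ⟨h1, fun h2 => ?_⟩
    rw [h2] at h1
    have h4 := congrArg σ h3
    have h5 := congrArg σ h4
    simp only [map_add, map_mul, ht, hx, hy, hz, h2] at h4 h5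
    apply hne₂
    rw [← he₁, ← he₂, ← he₃]
    have h6 : z * a - a * y = w * (y * z - z * a) := by linear_combination h4 - h5
    have h7 : y * z - z * a = w * (a * y - y * z) := by linear_combination h3 - h4
    linear_combination (a * y - y * z) ^ 2 * h1 + (y * z - z * a + (w + 1) * (a * y - y * z)) * h7
  have hr0 : (a * y + r) * (a * y + r') ≠ 0 := by
    rw [hquad']
    positivity
  have hr1 := left_ne_zero_of_mul hr0
  have hr2 := right_ne_zero_of_mul hr0
  have hW := right_root r hr (by linear_combination r * hrr₁ - hrr₂) hr1
  have hT := right_root r' hr' (by linear_combination r' * hrr₁ - hrr₂) hr2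
  have hU := left_root s hs (by linear_combination s * hss₁ - hss₂)
  have hV := left_root s' hs' (by linear_combination s' * hss₁ - hss₂)
  refine ⟨hA, hA1, ncard_solutions_eq_six hσ hA hA1 ?_ hU.1 hV.1 ?_ ?_ hW.1 hT.1 ?_ ?_
    hU.2 hV.2 hW.2 hT.2⟩
  · intro h1 h2
    obtain ⟨w, hw⟩ : ∃ w, y / a = w := ⟨_, rfl⟩
    rw [hw] at h1 h2
    have h3 : y = w * a := by rw [← hw]; field_simp
    have h4 := congrArg σ h3
    simp only [map_mul, hy, hz, h1] at h4
    apply hne₁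
    rw [← he₁, ← he₂, h4, h3]
    linear_combination (a ^ 2 * (w ^ 2 - 2 * w + 1)) * h2
  · field_simp
    linear_combination hquad
  · intro h
    rw [div_left_inj' ha] at h
    exact hss (add_left_cancel h)
  · rw [div_mul_div_comm, hquad', div_eq_div_iff (by positivity) ha]
    ring
  · intro h
    rw [div_eq_div_iff hr1 hr2] at h
    exact hrr (add_left_cancel (mul_left_cancel₀ (mul_ne_zero hy0 hz0) h)).symm

end Sixfold

/-! ### Cubics over `F` and conjugates in `K` -/

section Cubic

open Polynomial

theorem exists_root_of_cubic_of_finrank_eq_three {F K : Type*} [Field F] [Field K] [Algebra F K]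
    [Finite K] (hK : Module.finrank F K = 3) (e₁ e₂ e₃ : F)
    (h : ∀ t : F, t ^ 3 - e₁ * t ^ 2 + e₂ * t - e₃ ≠ 0) :
    ∃ a : K, a ^ 3 - algebraMap F K e₁ * a ^ 2 + algebraMap F K e₂ * a - algebraMap F K e₃ = 0 := by
  set p : F[X] := X ^ 3 - C e₁ * X ^ 2 + C e₂ * X - C e₃ with hp
  have hdeg : p.natDegree = 3 := by rw [hp]; compute_degree!
  have hmonic : p.Monic := by rw [hp]; monicity!
  have hirr : Irreducible p := by
    refine irreducible_of_degree_le_three_of_not_isRoot (by simp [hdeg]) fun t ht => h t ?_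
    simpa [hp] using ht
  have : Fact (Irreducible p) := ⟨hirr⟩
  have hrank : Module.finrank F (AdjoinRoot p) = 3 := by
    rw [(AdjoinRoot.powerBasis' hmonic).finrank, AdjoinRoot.powerBasis'_dim, hdeg]
  obtain ⟨f⟩ := FiniteField.nonempty_algHom_of_finrank_dvd (F := F) (K := AdjoinRoot p) (L := K)
    (by rw [hrank, hK])
  refine ⟨f (AdjoinRoot.root p), ?_⟩
  have hroot : aeval (f (AdjoinRoot.root p)) p = 0 := by
    rw [aeval_algHom_apply, AdjoinRoot.aeval_eq, AdjoinRoot.mk_self, map_zero]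
  simpa [hp] using hroot

theorem mem_range_algebraMap_of_pow_card_eq {F K : Type*} [Field F] [Field K] [Algebra F K]
    [Finite K] {a : K} (h : a ^ Nat.card F = a) : a ∈ Set.range (algebraMap F K) := by
  have := Finite.of_injective _ (algebraMap F K).injective
  have := Fintype.ofFinite F
  rw [Nat.card_eq_fintype_card] at h
  rw [IsGalois.mem_range_algebraMap_iff_fixed]
  intro f
  obtain ⟨i, rfl⟩ := (FiniteField.bijective_frobeniusAlgEquivOfAlgebraic_pow F K).2 f
  rw [AlgEquiv.coe_pow]
  exact Function.iterate_fixed (by simpa using h) _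

/-- A root of the cubic in `K` is not fixed by `σ`, hence Vieta's formulas hold for its conjugates. -/
theorem exists_conjugates_of_cubic {F K : Type*} [Field F] [Field K] [Algebra F K]
    [Finite K] (hK : Module.finrank F K = 3) {σ : K →ₐ[F] K} (hσ : ∀ x, σ (σ (σ x)) = x)
    (hfix : ∀ x, σ x = x → x ∈ Set.range (algebraMap F K)) (e₁ e₂ e₃ : F)
    (h : ∀ t : F, t ^ 3 - e₁ * t ^ 2 + e₂ * t - e₃ ≠ 0) :
    ∃ a : K, a ≠ 0 ∧ a + σ a + σ (σ a) = algebraMap F K e₁ ∧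
      a * σ a + σ a * σ (σ a) + σ (σ a) * a = algebraMap F K e₂ ∧
      a * σ a * σ (σ a) = algebraMap F K e₃ := by
  obtain ⟨a, ha⟩ := exists_root_of_cubic_of_finrank_eq_three hK e₁ e₂ e₃ h
  have ha' : σ a ≠ a := by
    intro ha'
    obtain ⟨t, rfl⟩ := hfix a ha'
    apply h t
    apply (algebraMap F K).injective
    simpa using ha
  have h1 := congrArg σ ha
  have h2 := congrArg σ h1
  simp only [map_add, map_sub, map_mul, map_pow, map_zero, AlgHom.commutes] at h1 h2
  have ha'' : σ (σ a) ≠ σ a := fun h => ha' (σ.injective h)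
  have ha''' : a ≠ σ (σ a) := fun h => ha'' (by
    have := congrArg σ h
    rw [hσ] at this
    rw [← h, this])
  have q1 : σ a ^ 2 + σ a * a + a ^ 2 - algebraMap F K e₁ * (σ a + a) + algebraMap F K e₂ = 0 :=
    mul_left_cancel₀ (sub_ne_zero.mpr ha') (by linear_combination h1 - ha)
  have q2 : σ (σ a) ^ 2 + σ (σ a) * σ a + σ a ^ 2 - algebraMap F K e₁ * (σ (σ a) + σ a) +
      algebraMap F K e₂ = 0 :=
    mul_left_cancel₀ (sub_ne_zero.mpr ha'') (by linear_combination h2 - h1)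
  have he₁ : a + σ a + σ (σ a) = algebraMap F K e₁ :=
    mul_left_cancel₀ (sub_ne_zero.mpr ha''') (by linear_combination q1 - q2)
  have he₂ : a * σ a + σ a * σ (σ a) + σ (σ a) * a = algebraMap F K e₂ := by
    linear_combination (a + σ a) * he₁ - q1
  refine ⟨a, ?_, he₁, he₂, ?_⟩
  · rintro rfl
    simp at ha'
  · linear_combination ha - a ^ 2 * he₁ + a * he₂

/-- The existence statement is reduced to a cubic over `F` without a root in `F` for which the two
quadratics `S ^ 2 + e₁ S + e₂` and `R ^ 2 + e₂ R + e₁ e₃` have distinct roots in `F`. -/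
theorem exists_ncard_eq_six_of_cubic {F K : Type*} [Field F] [Field K] [Algebra F K]
    [Finite F] (hK : Module.finrank F K = 3) (e₁ e₂ e₃ s s' r r' : F)
    (h : ∀ t : F, t ^ 3 - e₁ * t ^ 2 + e₂ * t - e₃ ≠ 0)
    (hss : s ≠ s') (hss₁ : s + s' = -e₁) (hss₂ : s * s' = e₂)
    (hrr : r ≠ r') (hrr₁ : r + r' = -e₂) (hrr₂ : r * r' = e₁ * e₃)
    (hne₁ : e₁ ^ 2 ≠ 3 * e₂) (hne₂ : e₂ ^ 2 ≠ 3 * (e₁ * e₃)) :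
    ∃ A : K, Algebra.norm F A = 1 ∧ A ≠ 1 ∧
      {X : K | Algebra.norm F X = 1 ∧ Algebra.norm F (X + 1) = -1 ∧
        Algebra.norm F (X + A) = -1}.ncard = 6 := by
  have : Module.Finite F K := Module.finite_of_finrank_pos (by simp [hK])
  have : Finite K := Module.finite_of_finite F
  have := Fintype.ofFinite F
  let σ := FiniteField.frobeniusAlgHom F K
  have hσ_apply : ∀ x, σ x = x ^ Nat.card F := by
    intro x
    simp [σ, Nat.card_eq_fintype_card]
  have hcard : Nat.card K = Nat.card F * (Nat.card F * Nat.card F) := by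
    rw [Module.natCard_eq_pow_finrank (K := F), hK]
    ring
  have hσ : ∀ x, σ (σ (σ x)) = x := by
    intro x
    rw [hσ_apply, hσ_apply, hσ_apply, ← pow_mul, ← pow_mul, ← hcard]
    have := Fintype.ofFinite K
    rw [Nat.card_eq_fintype_card, FiniteField.pow_card]
  have hnorm : ∀ x : K, algebraMap F K (Algebra.norm F x) = x * σ x * σ (σ x) := by
    intro x
    rw [FiniteField.algebraMap_norm_eq_prod_pow, hK, hσ_apply, hσ_apply]
    simp [Finset.prod_range_succ, ← pow_mul, sq]
  have hnorm_one : ∀ x : K, Algebra.norm F x = 1 ↔ x * σ x * σ (σ x) = 1 := by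
    intro x
    rw [← hnorm, ← map_one (algebraMap F K), (algebraMap F K).injective.eq_iff]
  have hnorm_neg_one : ∀ x : K, Algebra.norm F x = -1 ↔ x * σ x * σ (σ x) = -1 := by
    intro x
    rw [← hnorm, ← map_one (algebraMap F K), ← map_neg, (algebraMap F K).injective.eq_iff]
  obtain ⟨a, ha, ha₁, ha₂, ha₃⟩ := exists_conjugates_of_cubic hK hσ
    (fun x hx => mem_range_algebraMap_of_pow_card_eq ((hσ_apply x).symm.trans hx)) e₁ e₂ e₃ h
  have h3 : algebraMap F K 3 = 3 := map_ofNat _ 3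
  have inj := (algebraMap F K).injective
  have key := ncard_solutions_eq_six_of_splitting (σ := σ.toRingHom) hσ ha₁ ha₂ ha₃ ha
    (σ.commutes s) (σ.commutes s') (σ.commutes r) (σ.commutes r')
    (inj.ne hss) (by simp [← map_add, hss₁]) (by simp [← map_mul, hss₂])
    (inj.ne hrr) (by simp [← map_add, hrr₁]) (by simp [← map_mul, hrr₂])
    (by simpa [h3] using inj.ne hne₁) (by simpa [h3] using inj.ne hne₂)
  refine ⟨σ a / a, ?_⟩
  simp only [hnorm_one, hnorm_neg_one]
  exact key

end Cubic

/-! ### The Artin–Schreier map and odd characteristic -/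

section ArtinSchreier

/-- The additive map `x ↦ x ^ p - x` of a field of characteristic `p`. -/
def artinSchreierHom (F : Type*) [Field F] (p : ℕ) [Fact p.Prime] [CharP F p] : F →+ F :=
  (frobenius F p : F →+ F) - AddMonoidHom.id F

@[simp]
theorem artinSchreierHom_apply {F : Type*} [Field F] (p : ℕ) [Fact p.Prime] [CharP F p] (x : F) :
    artinSchreierHom F p x = x ^ p - x := rfl

theorem card_mul_card_range_artinSchreierHom (F : Type*) [Field F] (p : ℕ) [Fact p.Prime]
    [CharP F p] : p * Nat.card (artinSchreierHom F p).range = Nat.card F := by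
  have hker : Nat.card (artinSchreierHom F p).ker = p := by
    refine Eq.trans ?_ (Subfield.card_bot F p)
    refine Nat.card_congr (Equiv.subtypeEquivRight fun x => ?_)
    rw [AddMonoidHom.mem_ker, artinSchreierHom_apply, sub_eq_zero]
    exact (Subfield.mem_bot_iff_pow_eq_self F p).symm
  rw [← AddSubgroup.index_ker, ← (artinSchreierHom F p).ker.card_mul_index, hker]

end ArtinSchreier

section OddCharacteristic

variable {F K : Type*} [Field F] [Field K] [Algebra F K] [Finite F]

/-- With `e₁ = 0` and `e₂ = -1` the quadratics are `S ^ 2 - 1` and `R ^ 2 - R`, whatever `e₃` is. -/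
theorem exists_ncard_eq_six_of_two_three_ne_zero (hK : Module.finrank F K = 3)
    (h2 : (2 : F) ≠ 0) (h3 : (3 : F) ≠ 0) :
    ∃ A : K, Algebra.norm F A = 1 ∧ A ≠ 1 ∧
      {X : K | Algebra.norm F X = 1 ∧ Algebra.norm F (X + 1) = -1 ∧
        Algebra.norm F (X + A) = -1}.ncard = 6 := by
  have hnotinj : ¬ Function.Injective fun t : F => t ^ 3 - t := fun h =>
    zero_ne_one (α := F) (h (by simp))
  have hnotsurj : ¬ Function.Surjective fun t : F => t ^ 3 - t := fun h =>
    hnotinj (Finite.injective_iff_surjective.mpr h)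
  obtain ⟨e, he⟩ : ∃ e : F, ∀ t : F, t ^ 3 - t ≠ e := by
    simpa [Function.Surjective] using hnotsurj
  refine exists_ncard_eq_six_of_cubic hK 0 (-1) e 1 (-1) 0 1 (fun t ht => he t ?_)
    (fun h => h2 ?_) ?_ ?_ zero_ne_one ?_ ?_ ?_ ?_
  · linear_combination ht
  · linear_combination h
  all_goals simp [h3]

/-- The cubic is that of `1 / ξ + κ` with `ξ ^ 3 - ξ = η`; the two squares are, up to the factor
`1 / η ^ 2`, the discriminants of the two quadratics. -/
theorem exists_ncard_eq_six_of_artinSchreier [CharP F 3] (hK : Module.finrank F K = 3)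
    {κ η α β : F} (hκ : κ ≠ 0) (hη : ∀ x : F, x ^ 3 - x ≠ η)
    (hα : α ≠ 0) (hα' : 1 - κ * η = α ^ 2) (hβ : β ≠ 0) (hβ' : 1 + κ ^ 3 * η = β ^ 2) :
    ∃ A : K, Algebra.norm F A = 1 ∧ A ≠ 1 ∧
      {X : K | Algebra.norm F X = 1 ∧ Algebra.norm F (X + 1) = -1 ∧
        Algebra.norm F (X + A) = -1}.ncard = 6 := by
  have h3 : (3 : F) = 0 := CharP.cast_eq_zero F 3
  have hη0 : η ≠ 0 := fun h => hη 0 (by simp [h])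
  obtain ⟨θ, hθ⟩ : ∃ θ, θ * η = 1 := ⟨η⁻¹, inv_mul_cancel₀ hη0⟩
  have hθ0 : θ ≠ 0 := left_ne_zero_of_mul (hθ ▸ one_ne_zero)
  have h2 : (2 : F) ≠ 0 := fun h => one_ne_zero (α := F) (by linear_combination h3 - h)
  refine exists_ncard_eq_six_of_cubic hK (-θ) (κ * θ) (θ - κ ^ 2 * θ + κ ^ 3)
    (-θ * (1 + α)) (-θ * (1 - α)) (κ * θ - θ * β) (κ * θ + θ * β) ?_ ?_ ?_ ?_ ?_ ?_ ?_ ?_ ?_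
  · intro t ht
    -- A root `t` of the cubic would make `1 / (t - κ)` a root of `x ^ 3 - x - η`.
    have hx : (t - κ) ^ 3 + θ * (t - κ) ^ 2 - θ = 0 := by
      linear_combination ht + (-t ^ 2 * κ + t * κ ^ 2 - t * κ * θ) * h3
    have hx0 : t - κ ≠ 0 := by
      intro h
      rw [h] at hx
      exact hθ0 (by linear_combination -hx)
    obtain ⟨y, hy⟩ : ∃ y, y * (t - κ) = 1 := ⟨(t - κ)⁻¹, inv_mul_cancel₀ hx0⟩
    apply hη y
    obtain ⟨x, hxe⟩ : ∃ x, t - κ = x := ⟨_, rfl⟩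
    rw [hxe] at hx hx0 hy
    have hyinv : y = x⁻¹ := eq_inv_of_mul_eq_one_left hy
    have hηinv : η = θ⁻¹ := eq_inv_of_mul_eq_one_right hθ
    rw [hyinv, hηinv]
    field_simp
    linear_combination -hx
  · intro h
    exact mul_ne_zero h2 (mul_ne_zero hθ0 hα) (by linear_combination -h)
  · linear_combination -θ * h3
  · linear_combination θ ^ 2 * hα' + κ * θ * hθ
  · intro h
    exact mul_ne_zero h2 (mul_ne_zero hθ0 hβ) (by linear_combination -h)
  · linear_combination κ * θ * h3
  · linear_combination θ ^ 2 * hβ' - κ ^ 3 * θ * hθ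
  · rw [h3, zero_mul, neg_sq]
    positivity
  · rw [h3, zero_mul]
    positivity

/-- The conditions of `exists_ncard_eq_six_of_artinSchreier` are parametrized by `ν` and `v`. The
fibres of `v ↦ v⁻¹ - ν v` have at most two elements, so at most `2 q / 3 < q - 1` nonzero values of `v`
lead to an `η` of the form `x ^ 3 - x`. -/
theorem exists_ncard_eq_six_of_charP_three [CharP F 3] (hK : Module.finrank F K = 3)
    (hF : 4 < Nat.card F) :
    ∃ A : K, Algebra.norm F A = 1 ∧ A ≠ 1 ∧
      {X : K | Algebra.norm F X = 1 ∧ Algebra.norm F (X + 1) = -1 ∧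
        Algebra.norm F (X + A) = -1}.ncard = 6 := by
  classical
  have := Fintype.ofFinite F
  rw [Nat.card_eq_fintype_card] at hF
  have h3 : (3 : F) = 0 := CharP.cast_eq_zero F 3
  -- `-ν` is a nonsquare so that `1 + ν * v ^ 2` never vanishes, and `ν ≠ 1` makes `1 - κ * η` nonzero.
  obtain ⟨ν, hν, hν1⟩ : ∃ ν : F, (¬ IsSquare (-ν)) ∧ ν ≠ 1 := by
    obtain ⟨n, hn⟩ := FiniteField.exists_nonsquare (F := F) (by rw [ringChar.eq F 3]; decide)
    by_cases h : -n = 1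
    · obtain ⟨w, hw⟩ : ∃ w : F, w ∉ ({0, 1, -1} : Finset F) := by
        by_contra! hall
        have := Finset.card_le_card (fun x _ => hall x : Finset.univ ⊆ ({0, 1, -1} : Finset F))
        have := Finset.card_le_three (a := (0 : F)) (b := 1) (c := -1)
        rw [Finset.card_univ] at *
        omega
      simp only [Finset.mem_insert, Finset.mem_singleton, not_or] at hw
      refine ⟨w ^ 2, ?_, ?_⟩
      · rintro ⟨z, hz⟩
        apply hn
        refine ⟨z / w, ?_⟩
        have := hw.1
        field_simp
        linear_combination hz - w ^ 2 * h
      · rw [Ne, ← one_pow 2, sq_eq_sq_iff_eq_or_eq_neg]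
        tauto
    · exact ⟨-n, by simpa using hn, h⟩
  have hν0 : ν ≠ 0 := by rintro rfl; simp at hν
  have hν2 : 1 + ν ≠ 0 := fun h => hν ⟨1, by linear_combination -h⟩
  have hsq : ∀ v : F, 1 + ν * v ^ 2 ≠ 0 := by
    intro v h
    have hv : v ≠ 0 := by rintro rfl; simp at h
    exact hν ⟨v⁻¹, by field_simp; linear_combination -h⟩
  set g : F → F := fun v => ν / (1 + ν) ^ 3 * (v⁻¹ - ν * v) with hg
  have hc : ν / (1 + ν) ^ 3 ≠ 0 := by positivity
  obtain ⟨v, hv0, hv⟩ : ∃ v : F, v ≠ 0 ∧ ∀ x : F, x ^ 3 - x ≠ g v := by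
    by_contra! hall
    have hle := Finset.card_le_mul_card_image_of_maps_to (f := g) (s := Finset.univ.erase 0)
      (t := Finset.univ.image fun x : F => x ^ 3 - x)
      (fun v hv => by simpa using hall v (Finset.ne_of_mem_erase hv)) 2 (by
        intro b _
        rcases Finset.eq_empty_or_nonempty {a ∈ Finset.univ.erase 0 | g a = b} with h | ⟨w, hw⟩
        · simp [h]
        refine (Finset.card_le_card (t := {w, -(ν * w)⁻¹}) fun u hu => ?_).trans Finset.card_le_two
        simp only [Finset.mem_filter, Finset.mem_erase, Finset.mem_univ, and_true] at hw hu
        have h1 : u⁻¹ - ν * u = w⁻¹ - ν * w := mul_left_cancel₀ hc (hu.2.trans hw.2.symm)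
        have hu0 := hu.1
        have hw0 := hw.1
        have h2 : (u - w) * (u * (ν * w) + 1) = 0 := by
          field_simp at h1
          linear_combination -h1
        simp only [Finset.mem_insert, Finset.mem_singleton]
        rcases mul_eq_zero.mp h2 with h | h
        · exact .inl (sub_eq_zero.mp h)
        · right
          rw [eq_neg_iff_add_eq_zero]
          field_simp
          linear_combination h)
    have hcard := card_mul_card_range_artinSchreierHom F 3
    have hrange : (Finset.univ.image fun x : F => x ^ 3 - x).card =
        Nat.card (artinSchreierHom F 3).range := by
      rw [← Set.ncard_coe_finset, Finset.coe_image, Finset.coe_univ, Set.image_univ]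
      rfl
    rw [← hrange, Nat.card_eq_fintype_card] at hcard
    rw [Finset.card_erase_of_mem (Finset.mem_univ _), Finset.card_univ] at hle
    omega
  -- If `ν * v ^ 2 = 1`, then `g v = 0 = 0 ^ 3 - 0`, against the choice of `v`.
  have hv1 : 1 - ν * v ^ 2 ≠ 0 := by
    intro h
    apply hv 0
    have : v⁻¹ - ν * v = 0 := by field_simp; linear_combination h
    simp [hg, this]
  obtain ⟨d, hd⟩ : ∃ d, 1 - ν * v ^ 2 = d := ⟨_, rfl⟩
  rw [hd] at hv1
  refine exists_ncard_eq_six_of_artinSchreier hK (κ := v * (1 + ν) / d) (η := g v)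
    (α := (1 - ν) / (1 + ν)) (β := (1 + ν * v ^ 2) / d) (by positivity) hv
    (div_ne_zero (sub_ne_zero.mpr hν1.symm) hν2) ?_ (div_ne_zero (hsq v) hv1) ?_
  · simp only [hg]
    field_simp
    linear_combination d * ν * h3 - ν * hd
  · simp only [hg]
    field_simp
    linear_combination (-ν * v ^ 2 * d) * h3 + (ν * v ^ 2 - d * (1 - ν * v ^ 2 + d)) * hd

end OddCharacteristic

/-! ### Characteristic two: trace-zero elements and cubes -/

section CharTwo

variable {F : Type*} [Field F] [CharP F 2]

theorem mem_range_artinSchreierHom_two {y : F} :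
    y ∈ (artinSchreierHom F 2).range ↔ ∃ x, x ^ 2 + x = y := by
  simp [AddMonoidHom.mem_range, CharTwo.sub_eq_add]

theorem sq_add_self_mem (x : F) : x ^ 2 + x ∈ (artinSchreierHom F 2).range :=
  mem_range_artinSchreierHom_two.mpr ⟨x, rfl⟩

theorem sq_mem_iff {x : F} :
    x ^ 2 ∈ (artinSchreierHom F 2).range ↔ x ∈ (artinSchreierHom F 2).range := by
  have h := sq_add_self_mem x
  exact ⟨fun hx => (add_mem_cancel_left hx).mp h, fun hx => (add_mem_cancel_right hx).mp h⟩

/-- The number of nonzero `t` with `β * t ^ 3` of the form `x ^ 2 + x`. -/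
noncomputable def cubeCount (β : F) : ℕ :=
  {t : F | t ≠ 0 ∧ β * t ^ 3 ∈ (artinSchreierHom F 2).range}.ncard

theorem cubeCount_mul_cube (β : F) {x : F} (hx : x ≠ 0) : cubeCount (β * x ^ 3) = cubeCount β := by
  refine Set.ncard_congr (fun t _ => x * t) ?_ ?_ ?_
  · rintro t ⟨h1, h2⟩
    exact ⟨mul_ne_zero hx h1, by convert h2 using 1; ring⟩
  · rintro t u _ _ h
    exact mul_left_cancel₀ hx h
  · rintro t ⟨h1, h2⟩
    refine ⟨t / x, ⟨div_ne_zero h1 hx, ?_⟩, by field_simp⟩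
    convert h2 using 1
    field_simp

variable [Finite F]

/-- The elements `x ^ 2 + x` form a subgroup of index two. -/
theorem add_mem_of_notMem {x y : F} (hx : x ∉ (artinSchreierHom F 2).range)
    (hy : y ∉ (artinSchreierHom F 2).range) : x + y ∈ (artinSchreierHom F 2).range := by
  have hindex : (artinSchreierHom F 2).range.index = 2 := by
    have h1 := card_mul_card_range_artinSchreierHom F 2
    have h2 := (artinSchreierHom F 2).range.card_mul_index
    have h3 : 0 < Nat.card (artinSchreierHom F 2).range := Nat.card_pos
    rw [← h1, mul_comm] at h2
    exact Nat.eq_of_mul_eq_mul_right h3 h2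
  rw [AddSubgroup.add_mem_iff_of_index_two hindex]
  tauto

variable {K : Type*} [Field K] [Algebra F K]

/-- The map `t ↦ (t ^ 3 + t ^ 2 + b t) / b ^ 2` takes a value in `V` exactly when `t ^ 3 / b ^ 2 ∈ V`, since
it differs from `t ^ 3 / b ^ 2` by `(t / b) ^ 2 + t / b`. It vanishes at `0`, `c` and `c + 1`, so under the
bound on the number of such `t` it misses at least two elements of `V`, one of them different from `1`. -/
theorem exists_ncard_eq_six_of_card_le (hK : Module.finrank F K = 3) {b c : F}
    (hb : c ^ 2 + c = b) (hb0 : b ≠ 0) (hb1 : b ≠ 1)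
    (hB : 2 * {t : F | t ^ 3 / b ^ 2 ∈ (artinSchreierHom F 2).range}.ncard ≤ Nat.card F) :
    ∃ A : K, Algebra.norm F A = 1 ∧ A ≠ 1 ∧
      {X : K | Algebra.norm F X = 1 ∧ Algebra.norm F (X + 1) = -1 ∧
        Algebra.norm F (X + A) = -1}.ncard = 6 := by
  classical
  have h2 : (2 : F) = 0 := CharP.cast_eq_zero F 2
  have hmem : ∀ t : F, t ^ 3 / b ^ 2 ∈ (artinSchreierHom F 2).range ↔
      (t ^ 3 + t ^ 2 + b * t) / b ^ 2 ∈ (artinSchreierHom F 2).range := by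
    intro t
    rw [← add_mem_cancel_right (sq_add_self_mem (t / b))]
    convert Iff.rfl using 2
    field_simp
    ring
  have hzero : ∀ t ∈ ({c, c + 1} : Set F), t ^ 3 + t ^ 2 + b * t = 0 := by
    rintro t (rfl | h)
    · rw [← hb]
      linear_combination (t ^ 3 + t ^ 2) * h2
    · rw [Set.mem_singleton_iff] at h
      rw [← hb, h]
      linear_combination (c + 1) ^ 3 * h2
  -- The value `1` is excluded because `y = 1` would give the degenerate case `e₂ ^ 2 = 3 e₁ e₃`.
  obtain ⟨y, ⟨d, hd⟩, hy1, hy⟩ : ∃ y, (∃ d : F, d ^ 2 + d = y) ∧ y ≠ 1 ∧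
      ∀ t : F, (t ^ 3 + t ^ 2 + b * t) / b ^ 2 ≠ y := by
    by_contra! hall
    set V : Set F := ((artinSchreierHom F 2).range : Set F) with hV
    set B : Set F := {t : F | t ^ 3 / b ^ 2 ∈ (artinSchreierHom F 2).range} with hBdef
    have hsub : V \ {1} ⊆ (fun t => (t ^ 3 + t ^ 2 + b * t) / b ^ 2) '' (B \ {c, c + 1}) := by
      rintro y ⟨hyV, hy1⟩
      by_cases hy0 : y = 0
      · refine ⟨0, ⟨⟨0, by simp⟩, ?_⟩, by simp [hy0]⟩
        rintro (h | h)
        · exact hb0 (by rw [← hb, ← h]; simp)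
        · rw [Set.mem_singleton_iff] at h
          exact hb0 (by rw [← hb]; linear_combination -c * h)
      · obtain ⟨t, ht⟩ := hall y (mem_range_artinSchreierHom_two.mp hyV) hy1
        refine ⟨t, ⟨(hmem t).mpr (ht ▸ hyV), ?_⟩, ht⟩
        intro h
        apply hy0
        rw [← ht, hzero t h, zero_div]
    have h1 := (Set.ncard_le_ncard hsub).trans (Set.ncard_image_le)
    have h3 : ({c, c + 1} : Set F) ⊆ B := by
      intro t h
      rw [hBdef, Set.mem_ofPred_eq, hmem, hzero t h, zero_div]
      exact zero_mem _
    have h4 : ({c, c + 1} : Set F).ncard = 2 := Set.ncard_pair (by simp)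
    have h5 := Set.ncard_sdiff_add_ncard_of_subset h3
    have h6 : V.ncard ≤ (V \ {1}).ncard + 1 := by
      have := Set.ncard_le_ncard_sdiff_add_ncard V {1}
      rwa [Set.ncard_singleton] at this
    have h7 := card_mul_card_range_artinSchreierHom F 2
    have h8 : Nat.card (artinSchreierHom F 2).range = V.ncard := rfl
    omega
  refine exists_ncard_eq_six_of_cubic hK 1 b (b ^ 2 * y) c (c + 1) (b * d) (b * d + b)
    (fun t ht => hy t ?_) (by simp) ?_ ?_ (by simpa using hb0) ?_ ?_ ?_ ?_
  · field_simp
    linear_combination ht + t ^ 2 * h2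
  · linear_combination (c + 1) * h2
  · linear_combination hb
  · linear_combination (b * d + b) * h2
  · rw [← hd]
    ring
  · intro h
    exact hb1 (by linear_combination -h - b * h2)
  · intro h
    refine hy1 (mul_left_cancel₀ (pow_ne_zero 2 hb0) ?_)
    linear_combination -h - b ^ 2 * y * h2

theorem exists_ncard_eq_six_of_cube_injective (hK : Module.finrank F K = 3) (hF : 4 < Nat.card F)
    (hinj : Function.Injective fun x : F => x ^ 3) :
    ∃ A : K, Algebra.norm F A = 1 ∧ A ≠ 1 ∧
      {X : K | Algebra.norm F X = 1 ∧ Algebra.norm F (X + 1) = -1 ∧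
        Algebra.norm F (X + A) = -1}.ncard = 6 := by
  have h2 : (2 : F) = 0 := CharP.cast_eq_zero F 2
  obtain ⟨c, hc⟩ : ∃ c : F, c ∉ ({0, 1} : Set F) := by
    by_contra! hall
    have h1 := Set.ncard_le_ncard (fun x _ => hall x : Set.univ ⊆ ({0, 1} : Set F))
    have h3 : ({0, 1} : Set F).ncard = 2 := Set.ncard_pair zero_ne_one
    rw [Set.ncard_univ] at h1
    omega
  simp only [Set.mem_insert_iff, Set.mem_singleton_iff, not_or] at hc
  have hb0 : c ^ 2 + c ≠ 0 := by
    intro h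
    have : c * (c - 1) = 0 := by linear_combination h - c * h2
    rcases mul_eq_zero.mp this with h | h
    · exact hc.1 h
    · exact hc.2 (sub_eq_zero.mp h)
  refine exists_ncard_eq_six_of_card_le hK rfl hb0 (fun h => hc.2 (hinj ?_)) ?_
  · change c ^ 3 = 1 ^ 3
    linear_combination (c - 1) * h + (c - 1) * h2
  · rw [← card_mul_card_range_artinSchreierHom F 2]
    refine Nat.mul_le_mul_left 2 ?_
    refine Set.ncard_le_ncard_of_injOn (fun t => t ^ 3 / (c ^ 2 + c) ^ 2) (fun t ht => ht) ?_
    intro t _ u _ h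
    exact hinj ((div_left_inj' (pow_ne_zero 2 hb0)).mp h)

/-- This holds because `x ∈ V` if and only if `x ^ 2 ∈ V`. -/
theorem cubeCount_sq (β : F) : cubeCount (β ^ 2) = cubeCount β := by
  symm
  refine Set.ncard_congr (fun t _ => t ^ 2) ?_ ?_ ?_
  · rintro t ⟨h1, h2⟩
    refine ⟨pow_ne_zero 2 h1, ?_⟩
    rw [← sq_mem_iff] at h2
    convert h2 using 1
    ring
  · rintro t u _ _ h
    exact frobenius_inj F 2 h
  · rintro t ⟨h1, h2⟩
    obtain ⟨u, rfl⟩ := (Finite.injective_iff_surjective.mp (frobenius_inj F 2)) t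
    simp only [frobenius_def] at h1 h2
    refine ⟨u, ⟨by rintro rfl; simp at h1, ?_⟩, rfl⟩
    rw [← sq_mem_iff]
    convert h2 using 1
    ring

theorem exists_ncard_eq_six_of_cubeCount_le (hK : Module.finrank F K = 3) {b : F}
    (hb : b ∈ (artinSchreierHom F 2).range) (hb0 : b ≠ 0) (hb1 : b ≠ 1)
    (hB : 2 * (cubeCount b + 1) ≤ Nat.card F) :
    ∃ A : K, Algebra.norm F A = 1 ∧ A ≠ 1 ∧
      {X : K | Algebra.norm F X = 1 ∧ Algebra.norm F (X + 1) = -1 ∧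
        Algebra.norm F (X + A) = -1}.ncard = 6 := by
  obtain ⟨c, hc⟩ := mem_range_artinSchreierHom_two.mp hb
  refine exists_ncard_eq_six_of_card_le hK hc hb0 hb1 (le_trans ?_ hB)
  have hb2 : cubeCount b = cubeCount ((b ^ 2)⁻¹) := by
    rw [← cubeCount_mul_cube (b ^ 2)⁻¹ hb0]
    congr 1
    field_simp
  rw [hb2]
  refine Nat.mul_le_mul_left 2 ?_
  refine (Set.ncard_le_ncard (t := insert 0 _) ?_).trans (Set.ncard_insert_le 0 _)
  intro t ht
  by_cases h0 : t = 0
  · exact .inl h0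
  · refine .inr ⟨h0, ?_⟩
    rw [Set.mem_ofPred_eq, div_eq_inv_mul] at ht
    exact ht

end CharTwo

/-! ### Characteristic two with a primitive cube root of unity -/

section CubeRootsOfUnity

variable {F : Type*} [Field F] [CharP F 2] [Finite F]

/-- For fixed `t ≠ 0`, as `β` runs over the nonzero elements, `β * t ^ 3` takes each nonzero value
once; so the average of `cubeCount β` over `β ≠ 0` is `q / 2 - 1`. -/
theorem exists_cubeCount_le : ∃ β : F, β ≠ 0 ∧ 2 * (cubeCount β + 1) ≤ Nat.card F := by
  classical
  have := Fintype.ofFinite F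
  by_contra! hall
  have hV := card_mul_card_range_artinSchreierHom F 2
  set V := (artinSchreierHom F 2).range with hVdef
  have hVpos : 0 < Nat.card V := Nat.card_pos
  have hcount : ∀ t ∈ Finset.univ.erase (0 : F),
      (Finset.bipartiteBelow (fun β t => β * t ^ 3 ∈ V) (Finset.univ.erase (0 : F)) t).card =
        Nat.card V - 1 := by
    intro t ht
    have ht0 : t ^ 3 ≠ 0 := pow_ne_zero 3 (Finset.ne_of_mem_erase ht)
    have hpre : ((V : Set F) \ {0}).ncard = Nat.card V - 1 := by
      rw [Set.ncard_sdiff_singleton_of_mem (zero_mem V)]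
      rfl
    rw [← hpre, ← Set.ncard_coe_finset]
    refine Set.ncard_congr (fun β _ => β * t ^ 3) ?_ ?_ ?_
    · intro β hβ
      simp only [Finset.bipartiteBelow, Finset.coe_filter, Finset.mem_erase, Finset.mem_univ,
        and_true] at hβ
      exact ⟨hβ.2, mul_ne_zero hβ.1 ht0⟩
    · intro β γ _ _ h
      exact mul_right_cancel₀ ht0 h
    · rintro y ⟨hy, hy0⟩
      refine ⟨y / t ^ 3, ?_, div_mul_cancel₀ _ ht0⟩
      simp only [Finset.bipartiteBelow, Finset.coe_filter, Finset.mem_erase, Finset.mem_univ,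
        and_true]
      refine ⟨div_ne_zero hy0 ht0, ?_⟩
      rw [div_mul_cancel₀ _ ht0]
      exact hy
  have hcube : ∀ β ∈ Finset.univ.erase (0 : F), Nat.card V ≤
      (Finset.bipartiteAbove (fun β t => β * t ^ 3 ∈ V) (Finset.univ.erase (0 : F)) β).card := by
    intro β hβ
    have h1 : (Finset.bipartiteAbove (fun β t => β * t ^ 3 ∈ V)
        (Finset.univ.erase (0 : F)) β).card = cubeCount β := by
      rw [cubeCount, ← Set.ncard_coe_finset]
      congr 1
      ext t
      simp [Finset.bipartiteAbove, hVdef]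
    have h2 := hall β (Finset.ne_of_mem_erase hβ)
    omega
  have hsum := Finset.sum_card_bipartiteAbove_eq_sum_card_bipartiteBelow
    (s := Finset.univ.erase (0 : F)) (t := Finset.univ.erase (0 : F)) (fun β t => β * t ^ 3 ∈ V)
  rw [Finset.sum_congr rfl hcount, Finset.sum_const, smul_eq_mul] at hsum
  have hle := Finset.card_nsmul_le_sum _ _ _ hcube
  rw [hsum, smul_eq_mul] at hle
  have hpos : 0 < (Finset.univ.erase (0 : F)).card :=
    Finset.card_pos.mpr ⟨1, by simp⟩
  have := Nat.le_of_mul_le_mul_left hle hpos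
  omega

/-- The noncubes form at most two classes modulo cubes, and squaring exchanges them. -/
theorem cubeCount_eq_of_forall_cube_ne {β b : F} (hβ0 : β ≠ 0) (hb0 : b ≠ 0)
    (hβ : ∀ x : F, x ^ 3 ≠ β) (hb : ∀ x : F, x ^ 3 ≠ b) : cubeCount b = cubeCount β := by
  obtain ⟨g, hg⟩ := IsCyclic.exists_generator (α := Fˣ)
  have key : ∀ y : F, y ≠ 0 → ∃ i : ℤ, y = (g : F) ^ i := by
    intro y hy
    obtain ⟨i, hi⟩ := Subgroup.mem_zpowers_iff.mp (hg (Units.mk0 y hy))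
    exact ⟨i, by simpa using (congrArg Units.val hi).symm⟩
  obtain ⟨i, rfl⟩ := key β hβ0
  obtain ⟨j, rfl⟩ := key b hb0
  have hg0 : (g : F) ≠ 0 := g.ne_zero
  have notdvd : ∀ i : ℤ, (∀ x : F, x ^ 3 ≠ (g : F) ^ i) → ¬ (3 : ℤ) ∣ i := by
    rintro i h ⟨m, rfl⟩
    exact h ((g : F) ^ m) (by rw [← zpow_natCast, ← zpow_mul, mul_comm, Nat.cast_ofNat])
  have hi := notdvd i hβ
  have hj := notdvd j hb
  have hcases : (∃ m, j = i + m * 3) ∨ ∃ m, j = i * 2 + m * 3 := by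
    by_cases h : (3 : ℤ) ∣ j - i
    · obtain ⟨m, hm⟩ := h
      exact .inl ⟨m, by omega⟩
    · have : (3 : ℤ) ∣ j - i * 2 := by
        have h1 : i % 3 = 1 ∨ i % 3 = 2 := by omega
        have h2 : j % 3 = 1 ∨ j % 3 = 2 := by omega
        rcases h1 with h1 | h1 <;> rcases h2 with h2 | h2 <;> omega
      obtain ⟨m, hm⟩ := this
      exact .inr ⟨m, by omega⟩
  have hpow : ∀ m : ℤ, (g : F) ^ (m * 3) = ((g : F) ^ m) ^ 3 := fun m => by
    rw [zpow_mul, ← zpow_natCast, Nat.cast_ofNat]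
  rcases hcases with ⟨m, rfl⟩ | ⟨m, rfl⟩
  · rw [zpow_add₀ hg0, hpow, cubeCount_mul_cube _ (zpow_ne_zero m hg0)]
  · rw [zpow_add₀ hg0, hpow, cubeCount_mul_cube _ (zpow_ne_zero m hg0), ← cubeCount_sq (g ^ i : F),
      zpow_mul, ← zpow_natCast, Nat.cast_ofNat]

variable {ω : F}

/-- There are only `(q - 1) / 3` nonzero cubes, fewer than the `q / 2 - 1` nonzero elements of `V`. -/
theorem exists_mem_forall_cube_ne (hω : ω ^ 2 + ω + 1 = 0) (hF : 4 < Nat.card F) :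
    ∃ b ∈ (artinSchreierHom F 2).range, b ≠ 0 ∧ ∀ x : F, x ^ 3 ≠ b := by
  classical
  have := Fintype.ofFinite F
  by_contra! hall
  have hV := card_mul_card_range_artinSchreierHom F 2
  set V := (artinSchreierHom F 2).range with hVdef
  have hω3 : ω ^ 3 = 1 := by linear_combination (ω - 1) * hω
  have h2 : (2 : F) = 0 := CharP.cast_eq_zero F 2
  have hω1 : ω ≠ 1 := by
    rintro rfl
    exact one_ne_zero (α := F) (by linear_combination hω - h2)
  have hω0 : ω ≠ 0 := by rintro rfl; simp at hω
  have hle := Finset.mul_card_image_le_card_of_maps_to (f := fun x : F => x ^ 3)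
    (s := Finset.univ.filter fun x : F => x ≠ 0 ∧ x ^ 3 ∈ V)
    (t := Finset.univ.filter fun y : F => y ∈ V ∧ y ≠ 0)
    (fun x hx => by
      simp only [Finset.mem_filter, Finset.mem_univ, true_and] at hx ⊢
      exact ⟨hx.2, pow_ne_zero 3 hx.1⟩) 3 (by
      intro y hy
      simp only [Finset.mem_filter, Finset.mem_univ, true_and] at hy
      obtain ⟨x, rfl⟩ := hall y hy.1 hy.2
      have hx0 : x ≠ 0 := by rintro rfl; simp at hy
      have hcard : ({x, ω * x, ω ^ 2 * x} : Finset F).card = 3 := by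
        rw [Finset.card_eq_three]
        refine ⟨_, _, _, ?_, ?_, ?_, rfl⟩
        · intro h
          exact hω1 (mul_right_cancel₀ hx0 (by rw [one_mul, ← h]))
        · intro h
          have h1 : ω ^ 2 = 1 := mul_right_cancel₀ hx0 (by rw [one_mul, ← h])
          exact hω1 (by rw [pow_succ, h1, one_mul] at hω3; exact hω3)
        · intro h
          have h1 : ω = ω ^ 2 := mul_right_cancel₀ hx0 h
          exact hω1 (mul_left_cancel₀ hω0 (by rw [← sq, ← h1, mul_one]))
      refine hcard.symm.le.trans (Finset.card_le_card fun z hz => ?_)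
      simp only [Finset.mem_insert, Finset.mem_singleton] at hz
      simp only [Finset.mem_filter, Finset.mem_univ, true_and]
      have hz3 : z ^ 3 = x ^ 3 := by
        rcases hz with rfl | rfl | rfl
        · rfl
        · rw [mul_pow, hω3, one_mul]
        · linear_combination (ω ^ 3 + 1) * x ^ 3 * hω3
      refine ⟨⟨?_, by rw [hz3]; exact hy.1⟩, hz3⟩
      rintro rfl
      exact hy.2 (by rw [← hz3]; simp))
  have h1 : (Finset.univ.filter fun y : F => y ∈ V ∧ y ≠ 0).card = Nat.card V - 1 := by
    have h3 : ((V : Set F) \ {0}).ncard = Nat.card V - 1 := by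
      rw [Set.ncard_sdiff_singleton_of_mem (zero_mem V)]
      rfl
    rw [← h3, ← Set.ncard_coe_finset]
    congr 1
    ext y
    simp
  have h3 : (Finset.univ.filter fun x : F => x ≠ 0 ∧ x ^ 3 ∈ V).card ≤ Nat.card F - 1 := by
    have h4 : (Finset.univ.erase (0 : F)).card = Nat.card F - 1 := by
      rw [Finset.card_erase_of_mem (Finset.mem_univ _), Finset.card_univ, Nat.card_eq_fintype_card]
    rw [← h4]
    refine Finset.card_le_card fun x hx => ?_
    simp only [Finset.mem_filter, Finset.mem_univ, true_and] at hx
    simp [hx.1]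
  omega

/-- Otherwise `t ^ 3 ∉ V` for all `t` outside `E = {0, 1, ω, ω ^ 2}`. Then the biadditive form
`t ^ 2 * u + t * u ^ 2`, taken modulo `V`, would be nonzero on all `t, u` independent modulo `E`, against
additivity in `u`. Three elements independent modulo `E` exist because `q > 16`. -/
theorem exists_cube_mem (hω : ω ^ 2 + ω + 1 = 0) (hF : 16 < Nat.card F) :
    ∃ t : F, t ≠ 0 ∧ t ^ 3 ≠ 1 ∧ t ^ 3 ∈ (artinSchreierHom F 2).range := by
  classical
  have := Fintype.ofFinite F
  rw [Nat.card_eq_fintype_card] at hF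
  by_contra! hall
  set V := (artinSchreierHom F 2).range with hVdef
  have h2 : (2 : F) = 0 := CharP.cast_eq_zero F 2
  set E : Finset F := {0, 1, ω, ω ^ 2} with hE
  have hEcard : E.card ≤ 4 := Finset.card_le_four
  have hnot : ∀ t, t ∉ E → t ^ 3 ∉ V := by
    intro t ht
    simp only [hE, Finset.mem_insert, Finset.mem_singleton, not_or] at ht
    refine hall t ht.1 fun h => ?_
    have : (t - 1) * ((t - ω) * (t - ω ^ 2)) = 0 := by
      linear_combination h + (t - 1) * (ω - 1 - t) * hω
    simp only [mul_eq_zero, sub_eq_zero] at this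
    tauto
  have hform : ∀ t u, t ∉ E → u ∉ E → t + u ∉ E → t ^ 2 * u + t * u ^ 2 ∉ V := by
    intro t u ht hu htu hmem
    have h1 := add_mem_of_notMem (hnot t ht) (hnot u hu)
    apply hnot _ htu
    have : (t + u) ^ 3 = (t ^ 3 + u ^ 3) + (t ^ 2 * u + t * u ^ 2) := by
      linear_combination (t ^ 2 * u + t * u ^ 2) * h2
    rw [this]
    exact add_mem h1 hmem
  have hshift : ∀ t u, u ∉ E.image (t + ·) → t + u ∉ E := by
    intro t u hu h
    apply hu
    rw [Finset.mem_image]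
    exact ⟨t + u, h, by linear_combination t * h2⟩
  have hex : ∀ S : Finset F, S.card ≤ 16 → ∃ x, x ∉ S := by
    intro S hS
    by_contra! h
    have := Finset.card_le_card (fun x _ => h x : Finset.univ ⊆ S)
    rw [Finset.card_univ] at this
    omega
  have himage : ∀ t, (E.image (t + ·)).card ≤ 4 := fun t => Finset.card_image_le.trans hEcard
  obtain ⟨t, ht⟩ := hex E (by omega)
  obtain ⟨u, hu⟩ := hex (E ∪ E.image (t + ·))
    ((Finset.card_union_le _ _).trans (by have := himage t; omega))
  obtain ⟨v, hv⟩ := hex ((E ∪ E.image (t + ·)) ∪ (E.image (u + ·) ∪ E.image (t + u + ·)))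
    ((Finset.card_union_le _ _).trans (by
      have h1 := Finset.card_union_le E (E.image (t + ·))
      have h3 := Finset.card_union_le (E.image (u + ·)) (E.image (t + u + ·))
      have h4 := himage t
      have h5 := himage u
      have h6 := himage (t + u)
      omega))
  simp only [Finset.mem_union, not_or] at hu hv
  have htu := hform t u ht hu.1 (hshift t u hu.2)
  have htv := hform t v ht hv.1.1 (hshift t v hv.1.2)
  have huv : u + v ∉ E := hshift u v hv.2.1
  have htuv : t + (u + v) ∉ E := by
    rw [← add_assoc]
    exact hshift (t + u) v hv.2.2
  apply hform t (u + v) ht huv htuv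
  have : t ^ 2 * (u + v) + t * (u + v) ^ 2 =
      (t ^ 2 * u + t * u ^ 2) + (t ^ 2 * v + t * v ^ 2) := by
    linear_combination t * u * v * h2
  rw [this]
  exact add_mem_of_notMem htu htv

theorem exists_ncard_eq_six_of_cube_root_of_one {K : Type*} [Field K] [Algebra F K]
    (hK : Module.finrank F K = 3) (hω : ω ^ 2 + ω + 1 = 0) (hF : 16 < Nat.card F) :
    ∃ A : K, Algebra.norm F A = 1 ∧ A ≠ 1 ∧
      {X : K | Algebra.norm F X = 1 ∧ Algebra.norm F (X + 1) = -1 ∧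
        Algebra.norm F (X + A) = -1}.ncard = 6 := by
  obtain ⟨β, hβ0, hβ⟩ := exists_cubeCount_le (F := F)
  by_cases hcube : ∃ x : F, x ^ 3 = β
  · obtain ⟨x, rfl⟩ := hcube
    obtain ⟨t, ht0, ht1, ht⟩ := exists_cube_mem hω hF
    refine exists_ncard_eq_six_of_cubeCount_le hK ht (pow_ne_zero 3 ht0) ht1 ?_
    have h1 := cubeCount_mul_cube 1 ht0
    have h2 := cubeCount_mul_cube 1 (x := x) (by rintro rfl; simp at hβ0)
    rw [one_mul] at h1 h2
    rw [h1, ← h2]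
    exact hβ
  · obtain ⟨b, hb, hb0, hbcube⟩ := exists_mem_forall_cube_ne hω (by omega)
    refine exists_ncard_eq_six_of_cubeCount_le hK hb hb0 (fun h => hbcube 1 (by simp [h])) ?_
    rw [cubeCount_eq_of_forall_cube_ne hβ0 hb0 (by simpa using hcube) hbcube]
    exact hβ

end CubeRootsOfUnity

/-! ### The field with sixteen elements -/

section SixteenElements

variable {F : Type*} [Field F] [CharP F 2] [Finite F]

/-- A generator of the multiplicative group, or its inverse, is a root: the cyclotomic polynomial of
order `15` is the product of two reciprocal quartics modulo two. -/
theorem exists_root_of_card_eq_sixteen (hF : Nat.card F = 16) : ∃ f : F, f ^ 4 + f ^ 3 + 1 = 0 := by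
  have := Fintype.ofFinite F
  have h2 : (2 : F) = 0 := CharP.cast_eq_zero F 2
  obtain ⟨g, hg⟩ := IsCyclic.exists_generator (α := Fˣ)
  have hord : orderOf g = 15 := by
    rw [orderOf_eq_card_of_forall_mem_zpowers hg, Nat.card_units, hF]
  obtain ⟨x, hx⟩ : ∃ x : F, (g : F) = x := ⟨_, rfl⟩
  have hx0 : x ≠ 0 := hx ▸ g.ne_zero
  have hne : ∀ n : ℕ, x ^ n = 1 → 15 ∣ n := by
    intro n hn
    rw [← hord]
    apply orderOf_dvd_of_pow_eq_one
    ext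
    simpa [hx] using hn
  have h15 : x ^ 15 = 1 := by
    have := congrArg Units.val (pow_orderOf_eq_one g)
    simpa [hord, hx] using this
  have h3 : x ^ 3 - 1 ≠ 0 := fun h => by
    have := hne 3 (sub_eq_zero.mp h)
    omega
  have h5 : x ^ 5 - 1 ≠ 0 := fun h => by
    have := hne 5 (sub_eq_zero.mp h)
    omega
  have h5' : x ^ 10 + x ^ 5 + 1 = 0 :=
    (mul_eq_zero.mp (by linear_combination h15 : (x ^ 5 - 1) * (x ^ 10 + x ^ 5 + 1) = 0)).resolve_left h5
  have hfac : (x ^ 4 + x + 1) * (x ^ 4 + x ^ 3 + 1) = 0 := by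
    refine (mul_eq_zero.mp (?_ : (x ^ 2 + x + 1) * _ = 0)).resolve_left fun h => h3 ?_
    · grind
    · linear_combination (x - 1) * h
  rcases mul_eq_zero.mp hfac with h | h
  · refine ⟨x⁻¹, ?_⟩
    field_simp
    linear_combination h
  · exact ⟨x, h⟩

theorem exists_ncard_eq_six_of_card_eq_sixteen {K : Type*} [Field K] [Algebra F K]
    (hK : Module.finrank F K = 3) (hF : Nat.card F = 16) :
    ∃ A : K, Algebra.norm F A = 1 ∧ A ≠ 1 ∧
      {X : K | Algebra.norm F X = 1 ∧ Algebra.norm F (X + 1) = -1 ∧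
        Algebra.norm F (X + A) = -1}.ncard = 6 := by
  have := Fintype.ofFinite F
  have h2 : (2 : F) = 0 := CharP.cast_eq_zero F 2
  obtain ⟨f, hf⟩ := exists_root_of_card_eq_sixteen hF
  have h1 : (1 : F) ≠ 0 := one_ne_zero
  refine exists_ncard_eq_six_of_cubic hK 1 (f ^ 3 + f) (f ^ 3) (f ^ 3 + f ^ 2) (f ^ 3 + f ^ 2 + 1)
    (f ^ 2 + f + 1) (f ^ 3 + f ^ 2 + 1) ?_ ?_ ?_ ?_ ?_ ?_ ?_ ?_ ?_
  · intro t ht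
    -- Reducing `t ^ 16 - t` modulo the cubic leaves a quadratic that is coprime to the cubic.
    have ht16 : t ^ 16 = t := by
      rw [← hF, Nat.card_eq_fintype_card, FiniteField.pow_card]
    have ht4 : t ^ 4 = (f ^ 3 + f + 1) * t ^ 2 + f * t + f ^ 3 := by grind
    have ht8 : t ^ 8 = (f ^ 2 + 1) * t ^ 2 + (f ^ 3 + f ^ 2 + 1) * t + (f ^ 3 + 1) := by grind
    have ht2 : f ^ 4 * t ^ 2 + f ^ 3 * t + 1 = 0 := by grind
    grind
  all_goals grind

end SixteenElements

/-! ### All finite fields with more than four elements -/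

theorem exists_ncard_eq_six_of_charP_two {F K : Type*} [Field F] [Field K] [Algebra F K]
    [Finite F] [CharP F 2] (hK : Module.finrank F K = 3) (hF : 4 < Nat.card F) :
    ∃ A : K, Algebra.norm F A = 1 ∧ A ≠ 1 ∧
      {X : K | Algebra.norm F X = 1 ∧ Algebra.norm F (X + 1) = -1 ∧
        Algebra.norm F (X + A) = -1}.ncard = 6 := by
  by_cases hinj : Function.Injective fun x : F => x ^ 3
  · exact exists_ncard_eq_six_of_cube_injective hK hF hinj
  obtain ⟨x, y, hxy, hne⟩ : ∃ x y : F, x ^ 3 = y ^ 3 ∧ x ≠ y := by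
    simpa [Function.Injective] using hinj
  have hy : y ≠ 0 := by
    rintro rfl
    exact hne (by simpa using hxy)
  obtain ⟨ω, hω⟩ : ∃ ω : F, ω ^ 2 + ω + 1 = 0 := by
    refine ⟨x / y, ?_⟩
    have h : x ^ 2 + x * y + y ^ 2 = 0 :=
      mul_left_cancel₀ (sub_ne_zero.mpr hne) (by linear_combination hxy)
    field_simp
    linear_combination h
  have := Fintype.ofFinite F
  obtain ⟨n, -, hn⟩ := FiniteField.card F 2
  rw [← Nat.card_eq_fintype_card] at hn
  by_cases h16 : 16 < Nat.card F
  · exact exists_ncard_eq_six_of_cube_root_of_one hK hω h16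
  have hn4 : (n : ℕ) ≤ 4 := by
    by_contra! h
    have := Nat.pow_le_pow_right (n := 2) (by norm_num) h
    omega
  -- `8 - 1` is not divisible by `3`, the order of `ω`.
  have h8 : Nat.card F ≠ 8 := by
    intro h8
    have hpow : ω ^ 8 = ω := by
      rw [← h8, Nat.card_eq_fintype_card, FiniteField.pow_card]
    have h2 : (2 : F) = 0 := CharP.cast_eq_zero F 2
    exact one_ne_zero (α := F) (by grind)
  refine exists_ncard_eq_six_of_card_eq_sixteen hK ?_
  interval_cases (n : ℕ) <;> simp_all

theorem theorem4 (p k : ℕ) (hp : p.Prime) (hp3 : ¬ p ≡ 1 [MOD 3]) (hq : 4 < p ^ k)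
    (F K : Type*) [Field F] [Field K] [Algebra F K]
    (hF : Nat.card F = p ^ k) (hK : Module.finrank F K = 3) :
    ∃ A : K, Algebra.norm F A = 1 ∧ A ≠ 1 ∧
      {X : K | Algebra.norm F X = 1 ∧ Algebra.norm F (X + 1) = -1 ∧
        Algebra.norm F (X + A) = -1}.ncard = 6 := by
  have : Finite F := Nat.finite_of_card_ne_zero (by omega)
  have : Fact p.Prime := ⟨hp⟩
  have : CharP F p := by
    have := Fintype.ofFinite F
    exact charP_of_card_eq_prime_pow (f := k) (by rw [← Nat.card_eq_fintype_card, hF])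
  rw [← hF] at hq
  rcases eq_or_ne p 2 with rfl | hp2
  · exact exists_ncard_eq_six_of_charP_two hK hq
  rcases eq_or_ne p 3 with rfl | hp3'
  · exact exists_ncard_eq_six_of_charP_three hK hq
  refine exists_ncard_eq_six_of_two_three_ne_zero hK (fun h => ?_) (fun h => ?_)
  · have := (CharP.cast_eq_zero_iff F p 2).mp (by exact_mod_cast h)
    exact hp2 ((Nat.prime_dvd_prime_iff_eq hp Nat.prime_two).mp this)
  · have := (CharP.cast_eq_zero_iff F p 3).mp (by exact_mod_cast h)
    exact hp3' ((Nat.prime_dvd_prime_iff_eq hp Nat.prime_three).mp this)
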